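/- Let $d_1,d_2\ge 1$ and let $P,Q$ be Gaussian probability distributions (possibly degenerate) on $\mathbb{R}^{d_1}\times\mathbb{R}^{d_2}$, with points written $x=(x_1,x_2)$. Suppose that $P$ and $Q$ both have mean zero, that the marginal distribution of $x_1$ is the same under $P$ and $Q$, that the marginal distribution of $x_2$ is the same under $P$ and $Q$, and that $\mathbb{E}_P[x_1x_1^\top]=I_{d_1}$ and $\mathbb{E}_P[x_2x_2^\top]=I_{d_2}$. Let $\Sigma_P=\mathbb{E}_P[xx^\top]\in\mathbb{R}^{(d_1+d_2)\times(d_1+d_2)}$ and let $\lambda_{\min}(\Sigma_P)$ be its smallest eigenvalue. Let $$\mathcal{F}=\{\,x\mapsto f_1(x_1)+f_2(x_2)\;:\; f_i:\mathbb{R}^{d_i}\to\mathbb{R},\ \mathbb{E}_P[f_i(x_i)^2]<\infty \text{ for } i=1,2\,\}$$ (the $f_i$ being measurable with respect to the completed law of $x_i$), and define the $\mathcal{F}$-restricted error ratio $$\tau(P,Q,\mathcal{F})=\sup_{f,g\in\mathcal{F}}\frac{\mathbb{E}_Q[(f(x)-g(x))^2]}{\mathbb{E}_P[(f(x)-g(x))^2]}\in[0,\infty],$$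 with the conventions $0/0=0$ and $a/0=\infty$ for $a>0$. Then $$\tau(P,Q,\mathcal{F})\le\frac{2}{\lambda_{\min}(\Sigma_P)},$$ where the right-hand side is read as $\infty$ if $\lambda_{\min}(\Sigma_P)=0$. -/

import Mathlib

open MeasureTheory ProbabilityTheory
open scoped ENNReal

noncomputable section

/-- The matrix `E_μ[X Xᵀ]` of a random vector `X` with finitely many real coordinates. -/
def secondMomentMatrix {Ω ι : Type*} [MeasurableSpace Ω] (μ : Measure Ω) (X : Ω → ι → ℝ) :
    Matrix ι ι ℝ :=
  Matrix.of fun i j => ∫ ω, X ω i * X ω j ∂μ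

/-- The smallest eigenvalue of a (nonempty, symmetric) real matrix. -/
def lambdaMin {ι : Type*} [Fintype ι] [DecidableEq ι] (A : Matrix ι ι ℝ) : ℝ :=
  sInf (spectrum ℝ A)

/-- The coordinates of a point `x = (x₁, x₂)` of `ℝ^{d₁} × ℝ^{d₂}`, as one vector of length
`d₁ + d₂` indexed by the disjoint union of the two index sets. -/
def concatCoords {d₁ d₂ : ℕ} (x : EuclideanSpace ℝ (Fin d₁) × EuclideanSpace ℝ (Fin d₂)) :
    Fin d₁ ⊕ Fin d₂ → ℝ :=
  Sum.elim (fun i => x.1 i) (fun j => x.2 j)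

/-- The model class of all sums `f₁(x₁) + f₂(x₂)` with `E_P[f₁(x₁)²] < ∞` and
`E_P[f₂(x₂)²] < ∞`, the functions being measurable up to null sets of the marginals of `P`. -/
def additiveClass {X₁ X₂ : Type*} [MeasurableSpace X₁] [MeasurableSpace X₂]
    (P : Measure (X₁ × X₂)) : Set (X₁ × X₂ → ℝ) :=
  {f | ∃ (f₁ : X₁ → ℝ) (f₂ : X₂ → ℝ),
    MemLp f₁ 2 (P.map Prod.fst) ∧ MemLp f₂ 2 (P.map Prod.snd) ∧
      f = fun x => f₁ x.1 + f₂ x.2}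

/-- The restricted error ratio
`τ(P, Q, F) = sup_{f, g ∈ F} E_Q[(f - g)²] / E_P[(f - g)²]`, with values in `[0, ∞]`.
In `ℝ≥0∞` one has `0 / 0 = 0`, and `a / 0 = ∞` for `a ≠ 0`. -/
def restrictedErrorRatio {X : Type*} [MeasurableSpace X] (P Q : Measure X)
    (F : Set (X → ℝ)) : ℝ≥0∞ :=
  ⨆ f ∈ F, ⨆ g ∈ F,
    (∫⁻ x, ENNReal.ofReal ((f x - g x) ^ 2) ∂Q) / (∫⁻ x, ENNReal.ofReal ((f x - g x) ^ 2) ∂P)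

end

/-!
For a Gaussian vector with covariance matrix `A`, the normalized characters
`exp (i L) / E[exp (i L)]` of its coordinates `L` have Gram matrix `exp A`, taken entrywise. Let `B`
be `A` with the cross-covariance blocks erased. If `A - c B` is positive semidefinite then so is its
entrywise product with any entrywise power of `A`, by the Schur product theorem; as
`(A - c B) ⊙ A ^ k = A ^ (k + 1) - c B ^ (k + 1)`, the exponential series makes
`(exp A - 1) - c (exp B - 1)` positive semidefinite too. Characters being dense in `L²`, an
inequality `c (Var f + Var g) ≤ Var (f + g)` between linear functions of `x₁` and `x₂` extends to
all square-integrable ones. Under any other coupling of the same marginals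
`Var (f + g) ≤ 2 (Var f + Var g)`, which bounds the error ratio by `2 / c`; for standardized
marginals, `c` can be the smallest eigenvalue of the covariance matrix.
-/

open scoped Matrix ComplexOrder MatrixOrder

theorem posSemidef_of_hasSum {ι β R : Type*} [CommRing R] [PartialOrder R] [StarRing R]
    [StarOrderedRing R] [TopologicalSpace R] [IsTopologicalRing R] [ContinuousStar R]
    [OrderClosedTopology R] {M : β → Matrix ι ι R} {A : Matrix ι ι R}
    (hM : ∀ n, (M n).PosSemidef) (hA : ∀ i j, HasSum (fun n => M n i j) (A i j)) :
    A.PosSemidef := by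
  refine ⟨Matrix.IsHermitian.ext fun i j => ?_, fun x => ?_⟩
  · refine (hA j i).star.unique ?_
    simpa only [(hM _).isHermitian.apply] using hA i j
  · have hsum : HasSum (fun n => x.sum fun i xi => x.sum fun j xj => star xi * M n i j * xj)
        (x.sum fun i xi => x.sum fun j xj => star xi * A i j * xj) :=
      hasSum_sum fun i _ => hasSum_sum fun j _ => ((hA i j).mul_left _).mul_right _
    exact hsum.nonneg fun n => (hM n).2 x

theorem posSemidef_map_ofReal {ι 𝕜 : Type*} [RCLike 𝕜] [Finite ι] {A : Matrix ι ι ℝ}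
    (hA : A.PosSemidef) : (A.map (RCLike.ofReal : ℝ → 𝕜)).PosSemidef := by
  classical
  cases nonempty_fintype ι
  obtain ⟨C, rfl⟩ := CStarAlgebra.nonneg_iff_eq_star_mul_self.1 hA.nonneg
  have hmap : (star C * C).map (RCLike.ofReal : ℝ → 𝕜) =
      (C.map RCLike.ofReal)ᴴ * C.map RCLike.ofReal := by
    ext i j
    simp [Matrix.mul_apply]
  exact hmap ▸ Matrix.posSemidef_conjTranspose_mul_self _

/-- The matrix obtained from a two-by-two block matrix by replacing the off-diagonal blocks
with zero; it is the covariance matrix of a pair of vectors made uncorrelated. -/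
def blockDiagPart {ι κ R : Type*} [Zero R] (A : Matrix (ι ⊕ κ) (ι ⊕ κ) R) :
    Matrix (ι ⊕ κ) (ι ⊕ κ) R :=
  Matrix.fromBlocks A.toBlocks₁₁ 0 0 A.toBlocks₂₂

section BlockDiagPart

variable {ι κ R S : Type*}

theorem blockDiagPart_map [Zero R] [Zero S] (A : Matrix (ι ⊕ κ) (ι ⊕ κ) R) {f : R → S}
    (hf : f 0 = 0) : blockDiagPart (A.map f) = (blockDiagPart A).map f := by
  rw [blockDiagPart, blockDiagPart, Matrix.fromBlocks_map, Matrix.map_zero f hf,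
    Matrix.map_zero f hf]
  rfl

theorem blockDiagPart_hadamard [MulZeroClass R] (A B : Matrix (ι ⊕ κ) (ι ⊕ κ) R) :
    blockDiagPart (A ⊙ B) = blockDiagPart A ⊙ B := by
  ext (i | i) (j | j) <;> simp [blockDiagPart, Matrix.toBlocks₁₁, Matrix.toBlocks₂₂]

theorem isHermitian_blockDiagPart [AddMonoid R] [StarAddMonoid R]
    {A : Matrix (ι ⊕ κ) (ι ⊕ κ) R} (hA : A.IsHermitian) : (blockDiagPart A).IsHermitian :=
  (hA.submatrix Sum.inl).fromBlocks (by simp) (hA.submatrix Sum.inr)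

variable {A : Matrix (ι ⊕ κ) (ι ⊕ κ) ℝ} {c : ℝ}

theorem posSemidef_map_pow_sub_smul_blockDiagPart (hA : A.PosSemidef)
    (hAc : (A - c • blockDiagPart A).PosSemidef) (n : ℕ) :
    (A.map (· ^ (n + 1)) - c • blockDiagPart (A.map (· ^ (n + 1)))).PosSemidef := by
  induction n with
  | zero => simpa using hAc
  | succ n ih =>
    have hsucc : A.map (· ^ (n + 1 + 1)) - c • blockDiagPart (A.map (· ^ (n + 1 + 1))) =
        (A.map (· ^ (n + 1)) - c • blockDiagPart (A.map (· ^ (n + 1)))) ⊙ A := by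
      have hpow : A.map (· ^ (n + 1 + 1)) = A.map (· ^ (n + 1)) ⊙ A := by
        ext i j
        exact pow_succ _ _
      rw [hpow, blockDiagPart_hadamard]
      ext i j
      simp [sub_mul, mul_assoc]
    exact hsucc ▸ ih.hadamard hA

theorem hasSum_pow_succ_div_factorial (t : ℝ) :
    HasSum (fun n : ℕ => t ^ (n + 1) / (n + 1).factorial) (Real.exp t - 1) := by
  have h := NormedSpace.expSeries_div_hasSum_exp t
  rw [← Real.exp_eq_exp_ℝ] at h
  simpa using (hasSum_nat_add_iff' 1).2 h

theorem posSemidef_map_exp_sub_one_sub_smul_blockDiagPart (hA : A.PosSemidef)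
    (hAc : (A - c • blockDiagPart A).PosSemidef) :
    (A.map (fun t => Real.exp t - 1) -
      c • blockDiagPart (A.map fun t => Real.exp t - 1)).PosSemidef := by
  have hterm (n : ℕ) : (((n + 1).factorial : ℝ)⁻¹ •
      (A.map (· ^ (n + 1)) - c • blockDiagPart (A.map (· ^ (n + 1))))).PosSemidef :=
    (posSemidef_map_pow_sub_smul_blockDiagPart hA hAc n).smul (by positivity)
  refine posSemidef_of_hasSum hterm fun i j => ?_
  have h := (hasSum_pow_succ_div_factorial (A i j)).sub
    ((hasSum_pow_succ_div_factorial (blockDiagPart A i j)).mul_left c)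
  convert! h using 2 with n
  · simp [blockDiagPart_map]
    ring
  · simp [blockDiagPart_map]

theorem posSemidef_sub_smul_blockDiagPart_iff {𝕜 : Type*} [RCLike 𝕜] [Fintype ι] [Fintype κ]
    {A : Matrix (ι ⊕ κ) (ι ⊕ κ) 𝕜} (hA : A.IsHermitian) :
    (A - c • blockDiagPart A).PosSemidef ↔ ∀ a b,
      c * (RCLike.re (star a ⬝ᵥ A.toBlocks₁₁ *ᵥ a) + RCLike.re (star b ⬝ᵥ A.toBlocks₂₂ *ᵥ b)) ≤
        RCLike.re (star (Sum.elim a b) ⬝ᵥ A *ᵥ Sum.elim a b) := by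
  have hherm : (A - c • blockDiagPart A).IsHermitian :=
    hA.sub ((isHermitian_blockDiagPart hA).smul (IsSelfAdjoint.all c))
  have hform (a : ι → 𝕜) (b : κ → 𝕜) : RCLike.re
      (star (Sum.elim a b) ⬝ᵥ (A - c • blockDiagPart A) *ᵥ Sum.elim a b) =
      RCLike.re (star (Sum.elim a b) ⬝ᵥ A *ᵥ Sum.elim a b) -
        c * (RCLike.re (star a ⬝ᵥ A.toBlocks₁₁ *ᵥ a) +
          RCLike.re (star b ⬝ᵥ A.toBlocks₂₂ *ᵥ b)) := by
    have hstar : star (Sum.elim a b) = Sum.elim (star a) (star b) := by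
      ext (i | i) <;> rfl
    simp [Matrix.sub_mulVec, Matrix.smul_mulVec, blockDiagPart, Matrix.fromBlocks_mulVec, hstar,
      sumElim_dotProduct_sumElim, RCLike.smul_re, mul_add]
  have hnonneg (x : ι ⊕ κ → 𝕜) : 0 ≤ star x ⬝ᵥ (A - c • blockDiagPart A) *ᵥ x ↔
      0 ≤ RCLike.re (star x ⬝ᵥ (A - c • blockDiagPart A) *ᵥ x) := by
    rw [RCLike.nonneg_iff, and_iff_left (hherm.im_star_dotProduct_mulVec_self x)]
  simp only [Matrix.posSemidef_iff_dotProduct_mulVec, hherm, true_and, hnonneg]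
  constructor
  · intro h a b
    exact sub_nonneg.1 ((h _).trans_eq (hform a b))
  · intro h x
    rw [← Sum.elim_comp_inl_inr x, hform]
    exact sub_nonneg.2 (h _ _)

end BlockDiagPart

section GramExp

variable {H ι κ : Type*} [NormedAddCommGroup H] [InnerProductSpace ℂ H]

theorem mul_norm_sq_add_le_of_gram_eq_exp_sub_one [Fintype ι] [Fintype κ]
    {A : Matrix (ι ⊕ κ) (ι ⊕ κ) ℝ} {c : ℝ} (hA : A.PosSemidef)
    (hAc : (A - c • blockDiagPart A).PosSemidef) {u : ι → H} {v : κ → H}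
    (huv : Matrix.gram ℂ (Sum.elim u v) = A.map fun t => ((Real.exp t - 1 : ℝ) : ℂ))
    (a : ι → ℂ) (b : κ → ℂ) :
    c * (‖∑ i, a i • u i‖ ^ 2 + ‖∑ j, b j • v j‖ ^ 2) ≤
      ‖∑ i, a i • u i + ∑ j, b j • v j‖ ^ 2 := by
  have hgram : (Matrix.gram ℂ (Sum.elim u v) -
      c • blockDiagPart (Matrix.gram ℂ (Sum.elim u v))).PosSemidef := by
    have h := posSemidef_map_ofReal (𝕜 := ℂ)
      (posSemidef_map_exp_sub_one_sub_smul_blockDiagPart hA hAc)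
    convert! h using 1
    ext i j
    simp [huv, blockDiagPart_map]
  have h := (posSemidef_sub_smul_blockDiagPart_iff (Matrix.isHermitian_gram ℂ _)).1 hgram a b
  have h₁ : (Matrix.gram ℂ (Sum.elim u v)).toBlocks₁₁ = Matrix.gram ℂ u := rfl
  have h₂ : (Matrix.gram ℂ (Sum.elim u v)).toBlocks₂₂ = Matrix.gram ℂ v := rfl
  simpa only [h₁, h₂, Matrix.star_dotProduct_gram_mulVec, inner_self_eq_norm_sq,
    Fintype.sum_sum_type, Sum.elim_inl, Sum.elim_inr] using h

theorem mul_norm_sq_add_le_of_mem_closure_span {α β : Type*} {u : α → H} {v : β → H} {c : ℝ}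
    (h : ∀ (m n : ℕ) (i : Fin m → α) (j : Fin n → β) (a : Fin m → ℂ) (b : Fin n → ℂ),
      c * (‖∑ k, a k • u (i k)‖ ^ 2 + ‖∑ k, b k • v (j k)‖ ^ 2) ≤
        ‖∑ k, a k • u (i k) + ∑ k, b k • v (j k)‖ ^ 2)
    {x y : H} (hx : x ∈ (Submodule.span ℂ (Set.range u)).topologicalClosure)
    (hy : y ∈ (Submodule.span ℂ (Set.range v)).topologicalClosure) :
    c * (‖x‖ ^ 2 + ‖y‖ ^ 2) ≤ ‖x + y‖ ^ 2 := by
  have hclosed : IsClosed {p : H × H | c * (‖p.1‖ ^ 2 + ‖p.2‖ ^ 2) ≤ ‖p.1 + p.2‖ ^ 2} :=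
    isClosed_le (by fun_prop) (by fun_prop)
  have hspan : (Submodule.span ℂ (Set.range u) : Set H) ×ˢ (Submodule.span ℂ (Set.range v)) ⊆
      {p : H × H | c * (‖p.1‖ ^ 2 + ‖p.2‖ ^ 2) ≤ ‖p.1 + p.2‖ ^ 2} := by
    rintro ⟨x, y⟩ ⟨hx, hy⟩
    obtain ⟨m, a, i, rfl⟩ := Submodule.mem_span_set'.1 hx
    obtain ⟨n, b, j, rfl⟩ := Submodule.mem_span_set'.1 hy
    choose i' hi' using fun k => (i k).2
    choose j' hj' using fun k => (j k).2
    simpa only [hi', hj', Set.mem_ofPred_eq] using h m n i' j' a b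
  have hmem : (x, y) ∈ closure ((Submodule.span ℂ (Set.range u) : Set H) ×ˢ
      (Submodule.span ℂ (Set.range v) : Set H)) := by
    rw [closure_prod_eq]
    exact ⟨hx, hy⟩
  exact closure_minimal hspan hclosed hmem

end GramExp

/-- The matrix `Cov_μ[X, X]` of a random vector `X` with real coordinates. -/
noncomputable def covarianceMatrix {Ω ι : Type*} [MeasurableSpace Ω] (μ : Measure Ω)
    (X : Ω → ι → ℝ) : Matrix ι ι ℝ :=
  Matrix.of fun i j => cov[fun ω => X ω i, fun ω => X ω j; μ]

section CovarianceMatrix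

variable {Ω ι κ : Type*} [MeasurableSpace Ω] {μ : Measure Ω}

theorem isHermitian_covarianceMatrix (X : Ω → ι → ℝ) : (covarianceMatrix μ X).IsHermitian := by
  ext i j
  exact covariance_comm _ _

theorem dotProduct_covarianceMatrix_mulVec [IsFiniteMeasure μ] [Fintype ι] {X : Ω → ι → ℝ}
    (hX : ∀ i, MemLp (fun ω => X ω i) 2 μ) (a : ι → ℝ) :
    a ⬝ᵥ covarianceMatrix μ X *ᵥ a = Var[fun ω => ∑ i, a i * X ω i; μ] := by
  rw [variance_fun_sum fun i => (hX i).const_mul (a i)]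
  simp only [dotProduct, Matrix.mulVec, Finset.mul_sum, covarianceMatrix, Matrix.of_apply,
    covariance_const_mul_left, covariance_const_mul_right]
  exact Finset.sum_congr rfl fun i _ => Finset.sum_congr rfl fun j _ => by ring

theorem posSemidef_covarianceMatrix [IsFiniteMeasure μ] [Finite ι] {X : Ω → ι → ℝ}
    (hX : ∀ i, MemLp (fun ω => X ω i) 2 μ) : (covarianceMatrix μ X).PosSemidef := by
  cases nonempty_fintype ι
  refine .of_dotProduct_mulVec_nonneg (isHermitian_covarianceMatrix X) fun a => ?_
  rw [star_trivial, dotProduct_covarianceMatrix_mulVec hX]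
  exact variance_nonneg _ _

theorem posSemidef_covarianceMatrix_sub_smul_blockDiagPart [IsFiniteMeasure μ] [Fintype ι]
    [Fintype κ] {X : Ω → ι → ℝ} {Y : Ω → κ → ℝ} {c : ℝ}
    (hX : ∀ i, MemLp (fun ω => X ω i) 2 μ) (hY : ∀ j, MemLp (fun ω => Y ω j) 2 μ)
    (hc : ∀ (a : ι → ℝ) (b : κ → ℝ),
      c * (Var[fun ω => ∑ i, a i * X ω i; μ] + Var[fun ω => ∑ j, b j * Y ω j; μ]) ≤
        Var[fun ω => ∑ i, a i * X ω i + ∑ j, b j * Y ω j; μ]) :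
    (covarianceMatrix μ (fun ω => Sum.elim (X ω) (Y ω)) -
      c • blockDiagPart (covarianceMatrix μ fun ω => Sum.elim (X ω) (Y ω))).PosSemidef := by
  refine (posSemidef_sub_smul_blockDiagPart_iff (isHermitian_covarianceMatrix _)).2 fun a b => ?_
  have h₁ : (covarianceMatrix μ fun ω => Sum.elim (X ω) (Y ω)).toBlocks₁₁ =
    covarianceMatrix μ X := rfl
  have h₂ : (covarianceMatrix μ fun ω => Sum.elim (X ω) (Y ω)).toBlocks₂₂ =
    covarianceMatrix μ Y := rfl
  simpa only [h₁, h₂, star_trivial, RCLike.re_to_real, dotProduct_covarianceMatrix_mulVec hX,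
    dotProduct_covarianceMatrix_mulVec hY,
    dotProduct_covarianceMatrix_mulVec (X := fun ω => Sum.elim (X ω) (Y ω)) (Sum.rec hX hY),
    Fintype.sum_sum_type, Sum.elim_inl, Sum.elim_inr] using hc a b

end CovarianceMatrix

section FourierUniqueness

variable {E : Type*} [NormedAddCommGroup E] [NormedSpace ℝ E] [MeasurableSpace E]
  {μ : Measure E}

theorem charFunDual_withDensity_ofReal {u : E → ℝ} (hu : AEMeasurable u μ) (hu0 : 0 ≤ᵐ[μ] u)
    (L : StrongDual ℝ E) : charFunDual (μ.withDensity fun x => ENNReal.ofReal (u x)) L =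
      ∫ x, u x * Complex.exp (L x * Complex.I) ∂μ := by
  rw [charFunDual_apply, integral_withDensity_eq_integral_toReal_smul₀ (by fun_prop) (by simp)]
  refine integral_congr_ae ?_
  filter_upwards [hu0] with x hx
  simp [ENNReal.toReal_ofReal hx]

theorem integrable_mul_exp_dual_mul_I [BorelSpace E] {g : E → ℂ} (hg : Integrable g μ)
    (L : StrongDual ℝ E) : Integrable (fun x => g x * Complex.exp (L x * Complex.I)) μ :=
  hg.mul_bdd (c := 1) (by fun_prop) (.of_forall fun x => (Complex.norm_exp_ofReal_mul_I _).le)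

variable [CompleteSpace E] [SecondCountableTopology E] [BorelSpace E]

theorem ae_eq_of_forall_integral_mul_exp_eq [SigmaFinite μ] {u v : E → ℝ} (hu : Integrable u μ)
    (hv : Integrable v μ) (hu0 : 0 ≤ᵐ[μ] u) (hv0 : 0 ≤ᵐ[μ] v)
    (huv : ∀ L : StrongDual ℝ E, ∫ x, u x * Complex.exp (L x * Complex.I) ∂μ =
      ∫ x, v x * Complex.exp (L x * Complex.I) ∂μ) : u =ᵐ[μ] v := by
  have := isFiniteMeasure_withDensity_ofReal hu.2
  have := isFiniteMeasure_withDensity_ofReal hv.2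
  have hdens : μ.withDensity (fun x => ENNReal.ofReal (u x)) =
      μ.withDensity fun x => ENNReal.ofReal (v x) := by
    refine Measure.ext_of_charFunDual (funext fun L => ?_)
    rw [charFunDual_withDensity_ofReal hu.aemeasurable hu0,
      charFunDual_withDensity_ofReal hv.aemeasurable hv0, huv]
  rw [withDensity_eq_iff_of_sigmaFinite (by fun_prop) (by fun_prop)] at hdens
  filter_upwards [hdens, hu0, hv0] with x hx hux hvx
  exact (ENNReal.ofReal_eq_ofReal_iff hux hvx).1 hx

theorem ae_eq_zero_of_forall_integral_ofReal_mul_exp_eq_zero [SigmaFinite μ] {u : E → ℝ}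
    (hu : Integrable u μ)
    (h0 : ∀ L : StrongDual ℝ E, ∫ x, u x * Complex.exp (L x * Complex.I) ∂μ = 0) :
    u =ᵐ[μ] 0 := by
  have hposneg : (fun x => max (u x) 0) =ᵐ[μ] fun x => max (-u x) 0 := by
    refine ae_eq_of_forall_integral_mul_exp_eq hu.pos_part hu.neg_part
      (.of_forall fun x => le_max_right _ _) (.of_forall fun x => le_max_right _ _) fun L => ?_
    have hsub := integral_sub (integrable_mul_exp_dual_mul_I (hu.pos_part.ofReal (𝕜 := ℂ)) L)
      (integrable_mul_exp_dual_mul_I (hu.neg_part.ofReal (𝕜 := ℂ)) L)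
    simp only [RCLike.ofReal_eq_complex_ofReal, ← sub_mul,
      ← Complex.ofReal_sub, max_zero_sub_max_neg_zero_eq_self] at hsub
    rw [← sub_eq_zero, ← hsub, h0]
  filter_upwards [hposneg] with x hx
  rw [← max_zero_sub_max_neg_zero_eq_self (u x), hx, sub_self, Pi.zero_apply]

theorem re_ae_eq_zero_of_forall_integral_mul_exp_eq_zero [SigmaFinite μ] {g : E → ℂ}
    (hg : Integrable g μ)
    (h0 : ∀ L : StrongDual ℝ E, ∫ x, g x * Complex.exp (L x * Complex.I) ∂μ = 0) :
    (fun x => (g x).re) =ᵐ[μ] 0 := by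
  have hconj (L : StrongDual ℝ E) :
      ∫ x, starRingEnd ℂ (g x) * Complex.exp (L x * Complex.I) ∂μ = 0 := by
    rw [← map_zero (starRingEnd ℂ), ← h0 (-L), ← integral_conj]
    simp [← Complex.exp_conj]
  refine ae_eq_zero_of_forall_integral_ofReal_mul_exp_eq_zero hg.re fun L => ?_
  have hre (x : E) : (g x).re * Complex.exp (L x * Complex.I) =
      2⁻¹ * (g x * Complex.exp (L x * Complex.I) +
        starRingEnd ℂ (g x) * Complex.exp (L x * Complex.I)) := by
    rw [Complex.re_eq_add_conj]
    ring
  have hg' : Integrable (fun x => starRingEnd ℂ (g x)) μ :=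
    Complex.conjLIE.integrable_comp_iff.2 hg
  calc ∫ x, (g x).re * Complex.exp (L x * Complex.I) ∂μ
      = 2⁻¹ * (∫ x, g x * Complex.exp (L x * Complex.I) ∂μ +
          ∫ x, starRingEnd ℂ (g x) * Complex.exp (L x * Complex.I) ∂μ) := by
        simp only [hre]
        rw [integral_const_mul, integral_add (integrable_mul_exp_dual_mul_I hg L)
          (integrable_mul_exp_dual_mul_I hg' L)]
    _ = 0 := by rw [h0, hconj, add_zero, mul_zero]

theorem ae_eq_zero_of_forall_integral_mul_exp_eq_zero [SigmaFinite μ] {g : E → ℂ}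
    (hg : Integrable g μ)
    (h0 : ∀ L : StrongDual ℝ E, ∫ x, g x * Complex.exp (L x * Complex.I) ∂μ = 0) :
    g =ᵐ[μ] 0 := by
  have hre := re_ae_eq_zero_of_forall_integral_mul_exp_eq_zero hg h0
  have him := re_ae_eq_zero_of_forall_integral_mul_exp_eq_zero (hg.const_mul (-Complex.I))
    fun L => by simp only [mul_assoc, integral_const_mul, h0, mul_zero]
  filter_upwards [hre, him] with x hx hx'
  exact Complex.ext hx (by simpa using hx')

end FourierUniqueness

section Characters

variable {E F : Type*} [NormedAddCommGroup E] [NormedSpace ℝ E] [MeasurableSpace E]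
  [BorelSpace E] [NormedAddCommGroup F] [NormedSpace ℝ F] [MeasurableSpace F] [BorelSpace F]

/-- The character `x ↦ exp (i L x)` as an element of `L²(μ)`. -/
noncomputable def charLp (μ : Measure E) [IsFiniteMeasure μ] (L : StrongDual ℝ E) : Lp ℂ 2 μ :=
  BoundedContinuousFunction.toLp 2 μ ℂ (BoundedContinuousFunction.probCharDual L)

variable {μ : Measure E} [IsFiniteMeasure μ]

theorem coeFn_charLp (L : StrongDual ℝ E) :
    charLp μ L =ᵐ[μ] fun x => Complex.exp (L x * Complex.I) :=
  BoundedContinuousFunction.coeFn_toLp (p := 2) (μ := μ) ℂ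
    (BoundedContinuousFunction.probCharDual L)

theorem inner_charLp_left (L : StrongDual ℝ E) (g : Lp ℂ 2 μ) :
    inner ℂ (charLp μ L) g = ∫ x, g x * Complex.exp ((-L) x * Complex.I) ∂μ := by
  rw [L2.inner_def]
  refine integral_congr_ae ?_
  filter_upwards [coeFn_charLp (μ := μ) L] with x hx
  simp [hx, ← Complex.exp_conj]

theorem inner_charLp_charLp (L M : StrongDual ℝ E) :
    inner ℂ (charLp μ L) (charLp μ M) = charFunDual μ (M - L) := by
  rw [inner_charLp_left, charFunDual_apply]
  refine integral_congr_ae ?_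
  filter_upwards [coeFn_charLp (μ := μ) M] with x hx
  rw [hx, ← Complex.exp_add]
  simp [sub_eq_add_neg, add_mul]

theorem inner_charLp_zero_toLp_ofReal {f : E → ℝ}
    (hf : MemLp (fun x => (f x : ℂ)) 2 μ) :
    inner ℂ (charLp μ 0) (hf.toLp _) = ((∫ x, f x ∂μ : ℝ) : ℂ) := by
  rw [inner_charLp_left, ← integral_complex_ofReal]
  refine integral_congr_ae ?_
  filter_upwards [hf.coeFn_toLp] with x hx
  simp [hx]

theorem eq_zero_of_forall_inner_charLp_eq_zero [CompleteSpace E] [SecondCountableTopology E]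
    {g : Lp ℂ 2 μ} (hg : ∀ L, inner ℂ (charLp μ L) g = 0) : g = 0 := by
  refine (Lp.eq_zero_iff_ae_eq_zero).2 (ae_eq_zero_of_forall_integral_mul_exp_eq_zero
    ((Lp.memLp g).integrable (by norm_num)) fun L => ?_)
  simpa only [inner_charLp_left, neg_neg] using hg (-L)

theorem compMeasurePreserving_charLp {ν : Measure F} [IsFiniteMeasure ν] (T : E →L[ℝ] F)
    (hT : MeasurePreserving T μ ν) (L : StrongDual ℝ F) :
    Lp.compMeasurePreservingₗᵢ ℂ T hT (charLp ν L) = charLp μ (L.comp T) := by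
  refine Lp.ext ?_
  have hcomp : Lp.compMeasurePreservingₗᵢ ℂ T hT (charLp ν L) =ᵐ[μ] charLp ν L ∘ T :=
    Lp.coeFn_compMeasurePreserving _ hT
  filter_upwards [hcomp, hT.quasiMeasurePreserving.ae (coeFn_charLp (μ := ν) L),
    coeFn_charLp (μ := μ) (L.comp T)] with x hx hTx hLTx
  rw [hx, hLTx, Function.comp_apply, hTx]
  rfl

end Characters

section WickExponential

variable {E F : Type*} [NormedAddCommGroup E] [NormedSpace ℝ E] [MeasurableSpace E]
  [BorelSpace E] [NormedAddCommGroup F] [NormedSpace ℝ F] [MeasurableSpace F] [BorelSpace F]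

/-- The normalized character `exp (i L) / E_μ[exp (i L)]` as an element of `L²(μ)`. For Gaussian
`μ` and centred `L` it is the Wick exponential `:exp (i L):`, and such functions have inner
products `exp (Cov_μ[L, M])`. -/
noncomputable def wickExpLp (μ : Measure E) [IsFiniteMeasure μ] (L : StrongDual ℝ E) :
    Lp ℂ 2 μ :=
  (charFunDual μ L)⁻¹ • charLp μ L

variable {μ : Measure E}

theorem wickExpLp_zero [IsProbabilityMeasure μ] : wickExpLp μ 0 = charLp μ 0 := by
  simp [wickExpLp, charFunDual_apply]

theorem compMeasurePreserving_wickExpLp [IsFiniteMeasure μ] (T : E →L[ℝ] F)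
    (L : StrongDual ℝ F) :
    Lp.compMeasurePreservingₗᵢ ℂ T ⟨T.measurable, rfl⟩ (wickExpLp (μ.map T) L) =
      wickExpLp μ (L.comp T) := by
  rw [wickExpLp, map_smul, compMeasurePreserving_charLp, charFunDual_map, wickExpLp]

theorem charFunDual_ne_zero [IsGaussian μ] (L : StrongDual ℝ E) : charFunDual μ L ≠ 0 := by
  rw [IsGaussian.charFunDual_eq]
  exact Complex.exp_ne_zero _

theorem charFunDual_sub_eq_mul_exp_covariance [CompleteSpace E] [IsGaussian μ]
    (L M : StrongDual ℝ E) : charFunDual μ (M - L) =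
      starRingEnd ℂ (charFunDual μ L) * charFunDual μ M * Real.exp cov[L, M; μ] := by
  have hL := IsGaussian.memLp_dual μ L 2 (by simp)
  have hM := IsGaussian.memLp_dual μ M 2 (by simp)
  have hvar : Var[(M - L : StrongDual ℝ E); μ] =
      Var[M; μ] - 2 * cov[L, M; μ] + Var[L; μ] := by
    rw [covariance_comm, ← variance_sub hM hL]
    rfl
  have hmean : ∫ x, (M - L) x ∂μ = ∫ x, M x ∂μ - ∫ x, L x ∂μ :=
    integral_sub (hM.integrable (by norm_num)) (hL.integrable (by norm_num))
  simp only [IsGaussian.charFunDual_eq, integral_complex_ofReal, hvar, hmean]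
  rw [← Complex.exp_conj, ← Complex.exp_add, Complex.ofReal_exp, ← Complex.exp_add]
  congr 1
  simp only [map_sub, map_mul, map_div₀, Complex.conj_ofReal, Complex.conj_I, map_ofNat]
  push_cast
  ring

variable [CompleteSpace E] [IsGaussian μ]

theorem inner_wickExpLp_wickExpLp (L M : StrongDual ℝ E) :
    inner ℂ (wickExpLp μ L) (wickExpLp μ M) = Real.exp cov[L, M; μ] := by
  have hL : starRingEnd ℂ (charFunDual μ L) ≠ 0 := by simpa using charFunDual_ne_zero L
  have hM := charFunDual_ne_zero (μ := μ) M
  rw [wickExpLp, wickExpLp, inner_smul_left, inner_smul_right, inner_charLp_charLp,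
    charFunDual_sub_eq_mul_exp_covariance, map_inv₀]
  field_simp

theorem inner_wickExpLp_sub_wickExpLp_sub (L M : StrongDual ℝ E) :
    inner ℂ (wickExpLp μ L - wickExpLp μ 0) (wickExpLp μ M - wickExpLp μ 0) =
      ((Real.exp cov[L, M; μ] - 1 : ℝ) : ℂ) := by
  have h0 : ⇑(0 : StrongDual ℝ E) = (0 : E → ℝ) := rfl
  simp only [inner_sub_left, inner_sub_right, inner_wickExpLp_wickExpLp, h0,
    covariance_zero_left, covariance_zero_right]
  simp

theorem mem_closure_span_wickExpLp_sub [SecondCountableTopology E] {f : Lp ℂ 2 μ}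
    (hf : inner ℂ (charLp μ 0) f = 0) :
    f ∈ (Submodule.span ℂ
      (Set.range fun L => wickExpLp μ L - wickExpLp μ 0)).topologicalClosure := by
  rw [← Submodule.orthogonal_orthogonal_eq_closure, Submodule.mem_orthogonal]
  intro g hg
  have horth (L : StrongDual ℝ E) :
      inner ℂ (wickExpLp μ L) g = inner ℂ (charLp μ 0) g := by
    rw [← sub_eq_zero, ← wickExpLp_zero, ← inner_sub_left]
    exact (Submodule.mem_orthogonal _ g).1 hg _ (Submodule.subset_span ⟨L, rfl⟩)
  -- `g` and the constant `E g` have the same inner product with every character.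
  have hconst : g = inner ℂ (charLp μ 0) g • charLp μ 0 := by
    refine sub_eq_zero.1 (eq_zero_of_forall_inner_charLp_eq_zero fun L => ?_)
    have hL : charLp μ L = charFunDual μ L • wickExpLp μ L := by
      rw [wickExpLp, smul_inv_smul₀ (charFunDual_ne_zero L)]
    have hone : inner ℂ (wickExpLp μ L) (charLp μ 0) = 1 := by
      have h0 : ⇑(0 : StrongDual ℝ E) = (0 : E → ℝ) := rfl
      rw [← wickExpLp_zero, inner_wickExpLp_wickExpLp, h0, covariance_zero_right]
      simp
    rw [hL, inner_smul_left, inner_sub_right, inner_smul_right, horth, hone, mul_one, sub_self,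
      mul_zero]
  rw [hconst, inner_smul_left, hf, mul_zero]

end WickExponential

theorem norm_toLp_ofReal_sq {Ω : Type*} [MeasurableSpace Ω] {μ : Measure Ω} {f : Ω → ℝ}
    (hf : MemLp (fun ω => (f ω : ℂ)) 2 μ) : ‖hf.toLp _‖ ^ 2 = ∫ ω, f ω ^ 2 ∂μ := by
  rw [← inner_self_eq_norm_sq (𝕜 := ℂ), L2.inner_def]
  have h : ∫ ω, inner ℂ (hf.toLp _ ω) (hf.toLp _ ω) ∂μ = ((∫ ω, f ω ^ 2 ∂μ : ℝ) : ℂ) := by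
    rw [← integral_complex_ofReal]
    refine integral_congr_ae ?_
    filter_upwards [hf.coeFn_toLp] with ω hω
    rw [hω, RCLike.inner_apply, Complex.conj_ofReal, ← Complex.ofReal_mul, sq]
  exact congrArg Complex.re h

section GaussianVariance

variable {E F G : Type*} [NormedAddCommGroup E] [NormedSpace ℝ E] [MeasurableSpace E]
  [BorelSpace E] [NormedAddCommGroup F] [NormedSpace ℝ F] [CompleteSpace F]
  [SecondCountableTopology F] [MeasurableSpace F] [BorelSpace F] {P : Measure E} [IsGaussian P]
  {T : E →L[ℝ] F}

theorem compMeasurePreserving_mem_closure_span {f : Lp ℂ 2 (P.map T)}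
    (hf : inner ℂ (charLp (P.map T) 0) f = 0) :
    Lp.compMeasurePreservingₗᵢ ℂ T ⟨T.measurable, rfl⟩ f ∈ (Submodule.span ℂ (Set.range
      fun L : StrongDual ℝ F => wickExpLp P (L.comp T) - wickExpLp P 0)).topologicalClosure := by
  refine map_mem_closure (LinearIsometry.continuous _) (mem_closure_span_wickExpLp_sub hf) ?_
  have hspan : Submodule.span ℂ (Set.range fun L => wickExpLp (P.map T) L - wickExpLp (P.map T) 0) ≤
      (Submodule.span ℂ (Set.range fun L : StrongDual ℝ F =>
        wickExpLp P (L.comp T) - wickExpLp P 0)).comap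
          (Lp.compMeasurePreservingₗᵢ ℂ T ⟨T.measurable, rfl⟩).toLinearMap := by
    refine Submodule.span_le.2 (Set.range_subset_iff.2 fun L => Submodule.subset_span ⟨L, ?_⟩)
    simp [compMeasurePreserving_wickExpLp]
  exact hspan

variable [CompleteSpace E] [NormedAddCommGroup G] [NormedSpace ℝ G] [CompleteSpace G]
  [SecondCountableTopology G] [MeasurableSpace G] [BorelSpace G]
  {U : E →L[ℝ] G} {c : ℝ}

theorem mul_norm_sq_add_le_of_inner_charLp_zero
    (hc : ∀ (L : StrongDual ℝ F) (M : StrongDual ℝ G),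
      c * (Var[fun x => L (T x); P] + Var[fun x => M (U x); P]) ≤
        Var[fun x => L (T x) + M (U x); P])
    {f : Lp ℂ 2 (P.map T)} {g : Lp ℂ 2 (P.map U)} (hf : inner ℂ (charLp (P.map T) 0) f = 0)
    (hg : inner ℂ (charLp (P.map U) 0) g = 0) :
    c * (‖f‖ ^ 2 + ‖g‖ ^ 2) ≤ ‖Lp.compMeasurePreservingₗᵢ ℂ T ⟨T.measurable, rfl⟩ f +
      Lp.compMeasurePreservingₗᵢ ℂ U ⟨U.measurable, rfl⟩ g‖ ^ 2 := by
  rw [← (Lp.compMeasurePreservingₗᵢ ℂ T ⟨T.measurable, rfl⟩).norm_map f,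
    ← (Lp.compMeasurePreservingₗᵢ ℂ U ⟨U.measurable, rfl⟩).norm_map g]
  refine mul_norm_sq_add_le_of_mem_closure_span (fun m n L M a b => ?_)
    (compMeasurePreserving_mem_closure_span hf) (compMeasurePreserving_mem_closure_span hg)
  have hL (i : Fin m) : MemLp (fun x => L i (T x)) 2 P :=
    IsGaussian.memLp_dual P ((L i).comp T) 2 (by simp)
  have hM (j : Fin n) : MemLp (fun x => M j (U x)) 2 P :=
    IsGaussian.memLp_dual P ((M j).comp U) 2 (by simp)
  refine mul_norm_sq_add_le_of_gram_eq_exp_sub_one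
    (posSemidef_covarianceMatrix (X := fun x => Sum.elim (fun i => L i (T x)) fun j => M j (U x))
      (Sum.rec hL hM))
    (posSemidef_covarianceMatrix_sub_smul_blockDiagPart hL hM fun a b => ?_) ?_ a b
  · simpa using hc (∑ i, a i • L i) (∑ j, b j • M j)
  · ext (i | i) (j | j) <;> exact inner_wickExpLp_sub_wickExpLp_sub _ _

theorem mul_integral_sq_add_le_of_isGaussian
    (hc : ∀ (L : StrongDual ℝ F) (M : StrongDual ℝ G),
      c * (Var[fun x => L (T x); P] + Var[fun x => M (U x); P]) ≤
        Var[fun x => L (T x) + M (U x); P])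
    {f : F → ℝ} {g : G → ℝ} (hf : MemLp f 2 (P.map T)) (hg : MemLp g 2 (P.map U))
    (hf0 : ∫ y, f y ∂(P.map T) = 0) (hg0 : ∫ z, g z ∂(P.map U) = 0) :
    c * (∫ x, f (T x) ^ 2 ∂P + ∫ x, g (U x) ^ 2 ∂P) ≤ ∫ x, (f (T x) + g (U x)) ^ 2 ∂P := by
  have hf' : MemLp (fun y => (f y : ℂ)) 2 (P.map T) := hf.ofReal
  have hg' : MemLp (fun z => (g z : ℂ)) 2 (P.map U) := hg.ofReal
  have hfT : MemLp (fun x => (f (T x) : ℂ)) 2 P := hf'.comp_of_map T.measurable.aemeasurable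
  have hgU : MemLp (fun x => (g (U x) : ℂ)) 2 P := hg'.comp_of_map U.measurable.aemeasurable
  have hadd : MemLp (fun x => ((f (T x) + g (U x) : ℝ) : ℂ)) 2 P := by
    simp only [Complex.ofReal_add]
    exact hfT.add hgU
  have h := mul_norm_sq_add_le_of_inner_charLp_zero hc (f := hf'.toLp _) (g := hg'.toLp _)
    (by simp [inner_charLp_zero_toLp_ofReal, hf0]) (by simp [inner_charLp_zero_toLp_ofReal, hg0])
  have hsum : Lp.compMeasurePreservingₗᵢ ℂ T ⟨T.measurable, rfl⟩ (hf'.toLp _) +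
      Lp.compMeasurePreservingₗᵢ ℂ U ⟨U.measurable, rfl⟩ (hg'.toLp _) = hadd.toLp _ := by
    refine (hfT.toLp_add hgU).symm.trans ?_
    congr 1
    ext x
    simp
  rwa [hsum, norm_toLp_ofReal_sq, norm_toLp_ofReal_sq, norm_toLp_ofReal_sq,
    integral_map (f := fun y => f y ^ 2) T.measurable.aemeasurable (hf.1.pow 2),
    integral_map (f := fun z => g z ^ 2) U.measurable.aemeasurable (hg.1.pow 2)] at h

theorem mul_variance_add_le_of_isGaussian
    (hc : ∀ (L : StrongDual ℝ F) (M : StrongDual ℝ G),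
      c * (Var[fun x => L (T x); P] + Var[fun x => M (U x); P]) ≤
        Var[fun x => L (T x) + M (U x); P])
    {f : F → ℝ} {g : G → ℝ} (hf : MemLp f 2 (P.map T)) (hg : MemLp g 2 (P.map U)) :
    c * (Var[fun x => f (T x); P] + Var[fun x => g (U x); P]) ≤
      Var[fun x => f (T x) + g (U x); P] := by
  have hfT : MemLp (fun x => f (T x)) 2 P := hf.comp_of_map T.measurable.aemeasurable
  have hgU : MemLp (fun x => g (U x)) 2 P := hg.comp_of_map U.measurable.aemeasurable
  have hmean : ∫ x, (f (T x) + g (U x)) ∂P = ∫ x, f (T x) ∂P + ∫ x, g (U x) ∂P :=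
    integral_add (hfT.integrable (by norm_num)) (hgU.integrable (by norm_num))
  have hf0 : ∫ y, (f y - ∫ x, f (T x) ∂P) ∂(P.map T) = 0 := by
    rw [← integral_map T.measurable.aemeasurable hf.1, ← average_eq_integral _ f,
      integral_sub_average]
  have hg0 : ∫ z, (g z - ∫ x, g (U x) ∂P) ∂(P.map U) = 0 := by
    rw [← integral_map U.measurable.aemeasurable hg.1, ← average_eq_integral _ g,
      integral_sub_average]
  have h := mul_integral_sq_add_le_of_isGaussian hc (hf.sub (memLp_const _))
    (hg.sub (memLp_const _)) hf0 hg0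
  rw [variance_eq_integral hfT.1.aemeasurable, variance_eq_integral hgU.1.aemeasurable,
    variance_eq_integral (X := fun x => f (T x) + g (U x)) (hfT.add hgU).1.aemeasurable, hmean]
  simpa only [Pi.sub_apply, add_sub_add_comm] using h

end GaussianVariance

theorem variance_add_le_two_mul {Ω : Type*} [MeasurableSpace Ω] {μ : Measure Ω}
    [IsFiniteMeasure μ] {X Y : Ω → ℝ} (hX : MemLp X 2 μ) (hY : MemLp Y 2 μ) :
    Var[X + Y; μ] ≤ 2 * (Var[X; μ] + Var[Y; μ]) := by
  have hsub := variance_nonneg (X - Y) μ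
  rw [variance_sub hX hY] at hsub
  rw [variance_add hX hY]
  linarith

theorem mul_integral_sq_add_le_of_identDistrib {Ω Ω' : Type*} [MeasurableSpace Ω]
    [MeasurableSpace Ω'] {P : Measure Ω} {Q : Measure Ω'} [IsProbabilityMeasure P]
    [IsProbabilityMeasure Q] {X Y : Ω → ℝ} {X' Y' : Ω' → ℝ} {c : ℝ} (hX : MemLp X 2 P)
    (hY : MemLp Y 2 P) (hXX' : IdentDistrib X X' P Q) (hYY' : IdentDistrib Y Y' P Q)
    (hc0 : 0 ≤ c) (hc1 : c ≤ 1) (hc : c * (Var[X; P] + Var[Y; P]) ≤ Var[X + Y; P]) :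
    c * ∫ ω, (X' ω + Y' ω) ^ 2 ∂Q ≤ 2 * ∫ ω, (X ω + Y ω) ^ 2 ∂P := by
  have hX' : MemLp X' 2 Q := hXX'.memLp_iff.1 hX
  have hY' : MemLp Y' 2 Q := hYY'.memLp_iff.1 hY
  have hmean : Q[X' + Y'] = P[X + Y] := by
    rw [integral_add' (hX'.integrable (by norm_num)) (hY'.integrable (by norm_num)),
      integral_add' (hX.integrable (by norm_num)) (hY.integrable (by norm_num)),
      hXX'.integral_eq, hYY'.integral_eq]
  have hQ : ∫ ω, (X' ω + Y' ω) ^ 2 ∂Q = Var[X' + Y'; Q] + P[X + Y] ^ 2 := by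
    rw [variance_eq_sub (hX'.add hY'), hmean, sub_add_cancel]
    rfl
  have hP : ∫ ω, (X ω + Y ω) ^ 2 ∂P = Var[X + Y; P] + P[X + Y] ^ 2 := by
    rw [variance_eq_sub (hX.add hY), sub_add_cancel]
    rfl
  have hvar : Var[X' + Y'; Q] ≤ 2 * (Var[X; P] + Var[Y; P]) := by
    rw [hXX'.variance_eq, hYY'.variance_eq]
    exact variance_add_le_two_mul hX' hY'
  rw [hQ, hP]
  calc c * (Var[X' + Y'; Q] + P[X + Y] ^ 2)
      ≤ c * (2 * (Var[X; P] + Var[Y; P])) + 1 * P[X + Y] ^ 2 := by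
        rw [mul_add]
        gcongr
    _ ≤ 2 * Var[X + Y; P] + 2 * P[X + Y] ^ 2 := by
        rw [mul_left_comm]
        gcongr
        exact one_le_two
    _ = 2 * (Var[X + Y; P] + P[X + Y] ^ 2) := by ring

theorem restrictedErrorRatio_additiveClass_le {X₁ X₂ : Type*} [MeasurableSpace X₁]
    [MeasurableSpace X₂] {P Q : Measure (X₁ × X₂)} (h₁ : P.map Prod.fst = Q.map Prod.fst)
    (h₂ : P.map Prod.snd = Q.map Prod.snd) {K : ℝ} (hK : 0 ≤ K)
    (h : ∀ (f₁ : X₁ → ℝ) (f₂ : X₂ → ℝ), MemLp f₁ 2 (P.map Prod.fst) →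
      MemLp f₂ 2 (P.map Prod.snd) →
        ∫ x, (f₁ x.1 + f₂ x.2) ^ 2 ∂Q ≤ K * ∫ x, (f₁ x.1 + f₂ x.2) ^ 2 ∂P) :
    restrictedErrorRatio P Q (additiveClass P) ≤ ENNReal.ofReal K := by
  refine iSup₂_le fun f hf => iSup₂_le fun g hg => ENNReal.div_le_of_le_mul ?_
  obtain ⟨f₁, f₂, hf₁, hf₂, rfl⟩ := hf
  obtain ⟨g₁, g₂, hg₁, hg₂, rfl⟩ := hg
  have hlintegral {μ : Measure (X₁ × X₂)} (hμ₁ : P.map Prod.fst = μ.map Prod.fst)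
      (hμ₂ : P.map Prod.snd = μ.map Prod.snd) :
      ∫⁻ x, ENNReal.ofReal ((f₁ x.1 + f₂ x.2 - (g₁ x.1 + g₂ x.2)) ^ 2) ∂μ =
        ENNReal.ofReal (∫ x, ((f₁ - g₁) x.1 + (f₂ - g₂) x.2) ^ 2 ∂μ) := by
    have hmem : MemLp (fun x : X₁ × X₂ => (f₁ - g₁) x.1 + (f₂ - g₂) x.2) 2 μ :=
      ((hμ₁ ▸ hf₁.sub hg₁).comp_of_map measurable_fst.aemeasurable).add
        ((hμ₂ ▸ hf₂.sub hg₂).comp_of_map measurable_snd.aemeasurable)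
    rw [ofReal_integral_eq_lintegral_ofReal hmem.integrable_sq
      (.of_forall fun x => sq_nonneg _)]
    simp only [Pi.sub_apply, add_sub_add_comm]
  rw [hlintegral h₁ h₂, hlintegral rfl rfl, ← ENNReal.ofReal_mul hK]
  exact ENNReal.ofReal_le_ofReal (h _ _ (hf₁.sub hg₁) (hf₂.sub hg₂))

theorem secondMomentMatrix_eq_covarianceMatrix {Ω ι : Type*} [MeasurableSpace Ω] {μ : Measure Ω}
    [IsProbabilityMeasure μ] {X : Ω → ι → ℝ} (hX : ∀ i, MemLp (fun ω => X ω i) 2 μ)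
    (h0 : ∀ i, ∫ ω, X ω i ∂μ = 0) :
    secondMomentMatrix μ X = covarianceMatrix μ X := by
  ext i j
  simp [secondMomentMatrix, covarianceMatrix, covariance_eq_sub (hX i) (hX j), h0]

section LambdaMin

variable {ι κ : Type*} [Fintype ι] [Fintype κ] [DecidableEq ι] [DecidableEq κ]

theorem posSemidef_sub_lambdaMin_smul_one {A : Matrix ι ι ℝ} (hA : A.IsHermitian) :
    (A - lambdaMin A • (1 : Matrix ι ι ℝ)).PosSemidef := by
  rw [Matrix.posSemidef_iff_isHermitian_and_spectrum_nonneg]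
  refine ⟨hA.sub (Matrix.isHermitian_one.smul (.all _)), ?_⟩
  have hbdd : BddBelow (spectrum ℝ A) := A.finite_real_spectrum.bddBelow
  rw [← Algebra.algebraMap_eq_smul_one, ← spectrum.sub_singleton_eq]
  rintro _ ⟨a, ha, _, rfl, rfl⟩
  exact sub_nonneg.2 (csInf_le hbdd ha)

theorem lambdaMin_le_apply_self {A : Matrix ι ι ℝ} (hA : A.IsHermitian) (i : ι) :
    lambdaMin A ≤ A i i := by
  simpa using (posSemidef_sub_lambdaMin_smul_one hA).diag_nonneg (i := i)

theorem lambdaMin_mul_dotProduct_le {A : Matrix ι ι ℝ} (hA : A.IsHermitian) (a : ι → ℝ) :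
    lambdaMin A * (a ⬝ᵥ a) ≤ a ⬝ᵥ A *ᵥ a := by
  simpa [Matrix.sub_mulVec, Matrix.smul_mulVec] using
    (posSemidef_sub_lambdaMin_smul_one hA).dotProduct_mulVec_nonneg a

theorem lambdaMin_mul_variance_add_le {Ω : Type*} [MeasurableSpace Ω] {μ : Measure Ω}
    [IsFiniteMeasure μ] {X : Ω → ι → ℝ} {Y : Ω → κ → ℝ}
    (hX : ∀ i, MemLp (fun ω => X ω i) 2 μ) (hY : ∀ j, MemLp (fun ω => Y ω j) 2 μ)
    (hX1 : covarianceMatrix μ X = 1) (hY1 : covarianceMatrix μ Y = 1) (a : ι → ℝ) (b : κ → ℝ) :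
    lambdaMin (covarianceMatrix μ fun ω => Sum.elim (X ω) (Y ω)) *
        (Var[fun ω => ∑ i, a i * X ω i; μ] + Var[fun ω => ∑ j, b j * Y ω j; μ]) ≤
      Var[fun ω => ∑ i, a i * X ω i + ∑ j, b j * Y ω j; μ] := by
  have h := lambdaMin_mul_dotProduct_le
    (isHermitian_covarianceMatrix (μ := μ) fun ω => Sum.elim (X ω) (Y ω)) (Sum.elim a b)
  rw [dotProduct_covarianceMatrix_mulVec (Sum.rec hX hY), sumElim_dotProduct_sumElim] at h
  rw [← dotProduct_covarianceMatrix_mulVec hX, ← dotProduct_covarianceMatrix_mulVec hY, hX1, hY1,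
    Matrix.one_mulVec, Matrix.one_mulVec]
  simpa only [Fintype.sum_sum_type, Sum.elim_inl, Sum.elim_inr] using h

end LambdaMin

theorem dual_euclideanSpace_apply {ι : Type*} [Fintype ι] [DecidableEq ι]
    (L : StrongDual ℝ (EuclideanSpace ℝ ι)) (x : EuclideanSpace ℝ ι) :
    L x = ∑ i, L (EuclideanSpace.single i 1) * x i := by
  conv_lhs => rw [← (EuclideanSpace.basisFun ι ℝ).sum_repr x]
  simp [mul_comm]

section ConcatCoords

variable {d₁ d₂ : ℕ} {P : Measure (EuclideanSpace ℝ (Fin d₁) × EuclideanSpace ℝ (Fin d₂))}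
  [IsGaussian P]

theorem exists_dual_eq_concatCoords (k : Fin d₁ ⊕ Fin d₂) :
    ∃ L : StrongDual ℝ (EuclideanSpace ℝ (Fin d₁) × EuclideanSpace ℝ (Fin d₂)),
      ∀ x, L x = concatCoords x k := by
  cases k with
  | inl i => exact ⟨(EuclideanSpace.proj i).comp (.fst ℝ _ _), fun _ => rfl⟩
  | inr j => exact ⟨(EuclideanSpace.proj j).comp (.snd ℝ _ _), fun _ => rfl⟩

theorem memLp_concatCoords (k : Fin d₁ ⊕ Fin d₂) : MemLp (fun x => concatCoords x k) 2 P := by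
  obtain ⟨L, hL⟩ := exists_dual_eq_concatCoords k
  simpa only [← hL] using IsGaussian.memLp_dual P L 2 (by simp)

theorem integral_concatCoords (h0 : ∫ x, x ∂P = 0) (k : Fin d₁ ⊕ Fin d₂) :
    ∫ x, concatCoords x k ∂P = 0 := by
  obtain ⟨L, hL⟩ := exists_dual_eq_concatCoords k
  simp only [← hL]
  rw [L.integral_comp_id_comm IsGaussian.integrable_id, h0, map_zero]

theorem secondMomentMatrix_concatCoords (h0 : ∫ x, x ∂P = 0) :
    secondMomentMatrix P concatCoords = covarianceMatrix P concatCoords :=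
  secondMomentMatrix_eq_covarianceMatrix memLp_concatCoords (integral_concatCoords h0)

theorem lambdaMin_secondMomentMatrix_le_one (h0 : ∫ x, x ∂P = 0) (i : Fin d₁)
    (hcov : secondMomentMatrix P (fun x i => x.1 i) = 1) :
    lambdaMin (secondMomentMatrix P concatCoords) ≤ 1 := by
  have hdiag : secondMomentMatrix P concatCoords (.inl i) (.inl i) = 1 :=
    (congrFun₂ hcov i i).trans (Matrix.one_apply_eq i)
  have hherm : (secondMomentMatrix P concatCoords).IsHermitian :=
    secondMomentMatrix_concatCoords h0 ▸ isHermitian_covarianceMatrix _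
  exact hdiag ▸ lambdaMin_le_apply_self hherm (.inl i)

theorem lambdaMin_mul_variance_dual_add_le (h0 : ∫ x, x ∂P = 0)
    (hcov₁ : secondMomentMatrix P (fun x i => x.1 i) = 1)
    (hcov₂ : secondMomentMatrix P (fun x j => x.2 j) = 1)
    (L : StrongDual ℝ (EuclideanSpace ℝ (Fin d₁))) (M : StrongDual ℝ (EuclideanSpace ℝ (Fin d₂))) :
    lambdaMin (secondMomentMatrix P concatCoords) *
        (Var[fun x => L x.1; P] + Var[fun x => M x.2; P]) ≤
      Var[fun x => L x.1 + M x.2; P] := by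
  have hX (i : Fin d₁) : MemLp (fun x : EuclideanSpace ℝ (Fin d₁) × EuclideanSpace ℝ (Fin d₂) =>
      x.1 i) 2 P := memLp_concatCoords (.inl i)
  have hY (j : Fin d₂) : MemLp (fun x : EuclideanSpace ℝ (Fin d₁) × EuclideanSpace ℝ (Fin d₂) =>
      x.2 j) 2 P := memLp_concatCoords (.inr j)
  rw [secondMomentMatrix_eq_covarianceMatrix hX fun i => integral_concatCoords h0 (.inl i)]
    at hcov₁
  rw [secondMomentMatrix_eq_covarianceMatrix hY fun j => integral_concatCoords h0 (.inr j)]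
    at hcov₂
  rw [secondMomentMatrix_concatCoords h0]
  have h := lambdaMin_mul_variance_add_le hX hY hcov₁ hcov₂
    (fun i => L (EuclideanSpace.single i 1)) fun j => M (EuclideanSpace.single j 1)
  simp only [← dual_euclideanSpace_apply] at h
  exact h

end ConcatCoords

theorem mainTheorem1_general {E F : Type*} [NormedAddCommGroup E] [NormedSpace ℝ E]
    [CompleteSpace E] [SecondCountableTopology E] [MeasurableSpace E] [BorelSpace E]
    [NormedAddCommGroup F] [NormedSpace ℝ F] [CompleteSpace F] [SecondCountableTopology F]
    [MeasurableSpace F] [BorelSpace F] {P Q : Measure (E × F)} [IsGaussian P]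
    (h₁ : P.map Prod.fst = Q.map Prod.fst) (h₂ : P.map Prod.snd = Q.map Prod.snd) {c : ℝ}
    (hc1 : c ≤ 1)
    (hc : ∀ (L : StrongDual ℝ E) (M : StrongDual ℝ F),
      c * (Var[fun x => L x.1; P] + Var[fun x => M x.2; P]) ≤
        Var[fun x => L x.1 + M x.2; P]) :
    restrictedErrorRatio P Q (additiveClass P) ≤ 2 / ENNReal.ofReal c := by
  rcases le_or_gt c 0 with hc0 | hc0
  · rw [ENNReal.ofReal_of_nonpos hc0, ENNReal.div_zero two_ne_zero]
    exact le_top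
  have : IsProbabilityMeasure (Q.map Prod.fst) :=
    h₁ ▸ Measure.isProbabilityMeasure_map measurable_fst.aemeasurable
  have : IsProbabilityMeasure Q := Measure.isProbabilityMeasure_of_map (f := Prod.fst)
  have hfst : IdentDistrib Prod.fst Prod.fst P Q := ⟨by fun_prop, by fun_prop, h₁⟩
  have hsnd : IdentDistrib Prod.snd Prod.snd P Q := ⟨by fun_prop, by fun_prop, h₂⟩
  rw [← ENNReal.ofReal_ofNat 2, ← ENNReal.ofReal_div_of_pos hc0]
  refine restrictedErrorRatio_additiveClass_le h₁ h₂ (by positivity) fun f g hf hg => ?_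
  rw [div_mul_eq_mul_div, le_div_iff₀' hc0]
  exact mul_integral_sq_add_le_of_identDistrib
    (hf.comp_of_map measurable_fst.aemeasurable) (hg.comp_of_map measurable_snd.aemeasurable)
    (hfst.comp_of_aemeasurable hf.1.aemeasurable) (hsnd.comp_of_aemeasurable hg.1.aemeasurable)
    hc0.le hc1 (mul_variance_add_le_of_isGaussian (T := .fst ℝ E F) (U := .snd ℝ E F) hc hf hg)

theorem mainTheorem1 (d₁ d₂ : ℕ) (hd₁ : 0 < d₁) (hd₂ : 0 < d₂)
    (P Q : Measure (EuclideanSpace ℝ (Fin d₁) × EuclideanSpace ℝ (Fin d₂)))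
    (hP : IsGaussian P) (hQ : IsGaussian Q)
    (hP_mean : ∫ x, x ∂P = 0) (hQ_mean : ∫ x, x ∂Q = 0)
    (hmarg₁ : P.map Prod.fst = Q.map Prod.fst)
    (hmarg₂ : P.map Prod.snd = Q.map Prod.snd)
    (hcov₁ : secondMomentMatrix P (fun x i => x.1 i) = 1)
    (hcov₂ : secondMomentMatrix P (fun x j => x.2 j) = 1) :
    restrictedErrorRatio P Q (additiveClass P) ≤
      2 / ENNReal.ofReal (lambdaMin (secondMomentMatrix P concatCoords)) :=
  mainTheorem1_general hmarg₁ hmarg₂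
    (lambdaMin_secondMomentMatrix_le_one hP_mean ⟨0, hd₁⟩ hcov₁)
    (lambdaMin_mul_variance_dual_add_le hP_mean hcov₁ hcov₂)
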